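/- Let $I=[0,1]$ and let $(\Omega,\mathcal F,\mathbb P)$ be a probability space. For $0<p,q\le\infty$, $\alpha\in\mathbb R$ and $s>\max(1/p,1)-1$, put $M=\lfloor s\rfloor+1$. The logarithmic Besov space $B^{s,\alpha}_{p,q}(\mathbb R)$ consists of all (complex-valued) $f\in L_p(\mathbb R)$ with $$\|f\|_p+\Bigl(\int_0^1 t^{-sq}(1+|\log t|)^{-\alpha q}\sup_{0<h<t}\|\Delta_h^M f\|_p^q\,\frac{dt}{t}\Bigr)^{1/q}<\infty$$ (for $q=\infty$ the second term is $\operatorname{ess\,sup}_{0<t<1}t^{-s}(1+|\log t|)^{-\alpha}\sup_{0<h<t}\|\Delta_h^M f\|_p$), where $(\Delta_h^1f)(x)=f(x+h)-f(x)$ and $\Delta_h^{k+1}=\Delta_h^1\Delta_h^k$. The space $B^{s,\alpha}_{p,q}(I)$ consists of all $f\in L_p(I)$ that are the restriction to $I$ of some $g\in B^{s,\alpha}_{p,q}(\mathbb R)$. (a) If $\{\xi_{j,m}: j\ge 1,\ 0\le m\le 2^j-1\}$ are independent standard Gaussian random variables on $\Omega$, then almost surely $$\sup_{j\ge 1}\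 j^{-1/2}\max_{0\le m\le 2^j-1}|\xi_{j,m}|<\infty .$$ (b) Let $W=(W_t)_{t\ge0}$ be a Brownian motion on $\Omega$ (with almost surely continuous paths), and let $\xi_{j,m}=-2^{j/2}\bigl(W_{(m+1)2^{-j}}-2W_{(2m+1)2^{-j-1}}+W_{m2^{-j}}\bigr)$ be its normalized coefficients in the Faber system on $I$. Then almost surely $$\sup_{j\ge 1}\ j^{-1/2}\max_{0\le m\le 2^j-1}|\xi_{j,m}|<\infty ,$$ and almost surely the path $t\mapsto W_t$, $t\in I$, belongs to $B^{1/2,1/2}_{\infty,\infty}(I)$. -/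

import Mathlib

open MeasureTheory ProbabilityTheory Set
open scoped NNReal ENNReal

noncomputable section

/-- The measure `dt / t` on the interval `(0, 1)`. -/
def dtOverT : Measure ℝ :=
  (volume.restrict (Ioo (0 : ℝ) 1)).withDensity fun t => ENNReal.ofReal t⁻¹

/-- The `L_p`-modulus of smoothness of order `M`: the supremum over `0 < h < t` of the
`L_p(ℝ)`-(quasi-)norm of the iterated difference `Δ_h^M f`, where
`(Δ_h f)(x) = f (x + h) - f x`. -/
def diffModulus (M : ℕ) (p : ℝ≥0∞) (f : ℝ → ℂ) (t : ℝ) : ℝ≥0∞ :=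
  ⨆ h ∈ Ioo (0 : ℝ) t, eLpNorm ((fwdDiff h)^[M] f) p volume

/-- The (quasi-)norm of the logarithmic Besov space `B^{s,α}_{p,q}(ℝ)`, defined by differences of
order `M = ⌊s⌋ + 1`, for `0 < p, q ≤ ∞` and `s > max (1/p) 1 - 1` (so that `s > 0`):
the `L_p`-norm of `f` plus the `L_q((0,1), dt/t)`-norm of
`t ↦ t^{-s} (1 + |log t|)^{-α} sup_{0<h<t} ‖Δ_h^M f‖_p`;
for `q = ∞` the latter is the essential supremum over `0 < t < 1`. -/
def logBesovNorm (s α : ℝ) (p q : ℝ≥0∞) (f : ℝ → ℂ) : ℝ≥0∞ :=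
  eLpNorm f p volume +
    eLpNorm (fun t : ℝ => ENNReal.ofReal (t ^ (-s) * (1 + |Real.log t|) ^ (-α)) *
      diffModulus (⌊s⌋₊ + 1) p f t) q dtOverT

/-- `f` belongs to the logarithmic Besov space `B^{s,α}_{p,q}(ℝ)`. -/
def MemLogBesov (s α : ℝ) (p q : ℝ≥0∞) (f : ℝ → ℂ) : Prop :=
  MemLp f p volume ∧ logBesovNorm s α p q f < ∞

/-- `f` (of which only the values on `I = [0, 1]` matter) belongs to `B^{s,α}_{p,q}(I)`: it is in
`L_p(I)` and it is, as an element of `L_p(I)`, the restriction to `I` of some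
`g ∈ B^{s,α}_{p,q}(ℝ)`. -/
def MemLogBesovUnitInterval (s α : ℝ) (p q : ℝ≥0∞) (f : ℝ → ℂ) : Prop :=
  MemLp f p (volume.restrict (Icc (0 : ℝ) 1)) ∧
    ∃ g : ℝ → ℂ, MemLogBesov s α p q g ∧ g =ᵐ[volume.restrict (Icc (0 : ℝ) 1)] f

/-- The path `t ↦ W_t(ω)`, as a function of a real variable (the values at `t < 0` are immaterial).
-/
def samplePath {Ω : Type*} (W : ℝ≥0 → Ω → ℝ) (ω : Ω) (t : ℝ) : ℝ :=
  W t.toNNReal ω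

/-- The normalized coefficient `ξ_{j,m}` of `f` in the Faber system,
`ξ_{j,m} = -2^{j/2} (Δ²_{2^{-j-1}} f)(2^{-j} m)`, so that
`2^{-(j+2)/2} ξ_{j,m}` is the coefficient `-(1/2) (Δ²_{2^{-j-1}} f)(2^{-j} m)` of the hat function
supported on `[m 2^{-j}, (m+1) 2^{-j}]`. -/
def faberCoeff (f : ℝ → ℝ) (j m : ℕ) : ℝ :=
  -(2 : ℝ) ^ ((j : ℝ) / 2) * (fwdDiff (1 / 2 ^ (j + 1) : ℝ))^[2] f ((m : ℝ) / 2 ^ j)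

end

open MeasureTheory ProbabilityTheory Set Filter Topology
open scoped NNReal ENNReal

/-! Both parts rest on Borel–Cantelli. At level `j` there are at most `2^(j+1)` standard Gaussians,
and each exceeds `2√(j+1)` in modulus with probability at most `2e^{-2(j+1)}`. The union bounds form
a convergent geometric series because `2e^{-2} < 1`, so almost surely only finitely many levels are
bad.

For Brownian motion this is applied to the rescaled dyadic increments rather than to the Faber
coefficients (`HasDyadicIncrementBound`). The rest is deterministic. A Faber coefficient is a
difference of two adjacent increments one level down. Chaining along dyadic approximations turns the
grid bound into Lévy's modulus `√(t(1+|log t|))` on `[0,1]`, which is the reciprocal of the weight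
of `B^{1/2,1/2}_{∞,∞}`. -/

/-- Gaussian tail bound. -/
lemma measure_le_abs_le_of_hasLaw_gaussianReal {Ω : Type*} [MeasurableSpace Ω] {P : Measure Ω}
    [IsProbabilityMeasure P] {X : Ω → ℝ} (hX : HasLaw X (gaussianReal 0 1) P) {ε : ℝ}
    (hε : 0 ≤ ε) :
    P {ω | ε ≤ |X ω|} ≤ ENNReal.ofReal (2 * Real.exp (-ε ^ 2 / 2)) := by
  have hsub : HasSubgaussianMGF X 1 P := by
    refine ⟨fun t => ?_, fun t => ?_⟩
    · have h := integrable_exp_mul_gaussianReal (μ := 0) (v := 1) t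
      rw [← hX.map_eq] at h
      exact h.comp_aemeasurable hX.aemeasurable
    · rw [mgf_gaussianReal hX.map_eq]
      simp
  have h1 := hsub.measure_ge_le hε
  have h2 := hsub.neg.measure_ge_le hε
  have hsubset : {ω | ε ≤ |X ω|} ⊆ {ω | ε ≤ X ω} ∪ {ω | ε ≤ (-X) ω} := by
    intro ω hω
    rcases le_abs.1 (show ε ≤ |X ω| from hω) with h | h
    · exact Or.inl h
    · exact Or.inr h
  rw [← ofReal_measureReal]
  refine ENNReal.ofReal_le_ofReal ?_
  calc P.real {ω | ε ≤ |X ω|} ≤ P.real ({ω | ε ≤ X ω} ∪ {ω | ε ≤ (-X) ω}) :=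
        measureReal_mono hsubset
    _ ≤ _ := measureReal_union_le _ _
    _ ≤ _ := by
        simp only [NNReal.coe_one, mul_one] at h1 h2
        linarith

/-- A countable family of standard Gaussian variables arranged in levels of exponential size grows
at most like the square root of the level. Independence is not needed. -/
lemma ae_exists_abs_le_mul_sqrt {Ω : Type*} [MeasurableSpace Ω] {P : Measure Ω}
    [IsProbabilityMeasure P] {ι : ℕ → Type*} [∀ j, Fintype (ι j)]
    (hι : ∀ j, Fintype.card (ι j) ≤ 2 ^ (j + 1)) (η : ∀ j, ι j → Ω → ℝ)
    (hη : ∀ j i, HasLaw (η j i) (gaussianReal 0 1) P) :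
    ∀ᵐ ω ∂P, ∃ C : ℝ, 0 ≤ C ∧ ∀ j i, |η j i ω| ≤ C * √(j + 1) := by
  let s : ℕ → Set Ω := fun j => ⋃ i : ι j, {ω | 2 * √((j : ℝ) + 1) ≤ |η j i ω|}
  have hr : 2 * Real.exp (-2) < 1 := by
    have h := Real.exp_one_gt_d9
    have : Real.exp (-2) = (Real.exp 1 * Real.exp 1)⁻¹ := by
      rw [← Real.exp_add, ← Real.exp_neg]; norm_num
    rw [this, ← div_eq_mul_inv, div_lt_one (by positivity)]
    nlinarith
  have hs : ∀ j, P (s j) ≤ ENNReal.ofReal (2 * (2 * Real.exp (-2)) ^ (j + 1)) := by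
    intro j
    have hexp : Real.exp (-(2 * √((j : ℝ) + 1)) ^ 2 / 2) = Real.exp (-2) ^ (j + 1) := by
      rw [mul_pow, Real.sq_sqrt (by positivity), ← Real.exp_nat_mul]
      push_cast
      ring_nf
    calc P (s j) ≤ ∑ i : ι j, P {ω | 2 * √((j : ℝ) + 1) ≤ |η j i ω|} :=
          measure_iUnion_fintype_le _ _
      _ ≤ ∑ _i : ι j, ENNReal.ofReal (2 * Real.exp (-2) ^ (j + 1)) := by
          refine Finset.sum_le_sum fun i _ => ?_
          rw [← hexp]
          exact measure_le_abs_le_of_hasLaw_gaussianReal (hη j i) (by positivity)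
      _ = ENNReal.ofReal (Fintype.card (ι j) * (2 * Real.exp (-2) ^ (j + 1))) := by
          rw [ENNReal.ofReal_mul (by positivity)]
          simp
      _ ≤ _ := by
          refine ENNReal.ofReal_le_ofReal ?_
          have : (Fintype.card (ι j) : ℝ) ≤ 2 ^ (j + 1) := by exact_mod_cast hι j
          calc _ ≤ (2 : ℝ) ^ (j + 1) * (2 * Real.exp (-2) ^ (j + 1)) := by gcongr
            _ = _ := by rw [mul_pow]; ring
  have hsum : (∑' j, P (s j)) ≠ ∞ := by
    refine ne_top_of_le_ne_top ?_ (ENNReal.tsum_le_tsum hs)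
    refine Summable.tsum_ofReal_ne_top ?_
    refine Summable.mul_left 2 ?_
    exact (summable_nat_add_iff 1).2 (summable_geometric_of_lt_one (by positivity) hr)
  filter_upwards [ae_eventually_notMem hsum] with ω hω
  obtain ⟨N, hN⟩ := eventually_atTop.1 hω
  -- The finite sum absorbs the levels below `N`, where `√(j+1) ≥ 1` suffices; the 2 serves the good
  -- levels.
  refine ⟨2 + ∑ j ∈ Finset.range N, ∑ i, |η j i ω|, by positivity, fun j i => ?_⟩
  have hS : 0 ≤ ∑ j ∈ Finset.range N, ∑ i, |η j i ω| := by positivity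
  rcases lt_or_ge j N with hj | hj
  · have h1 : |η j i ω| ≤ ∑ i, |η j i ω| :=
      Finset.single_le_sum (f := fun i => |η j i ω|) (fun _ _ => abs_nonneg _) (Finset.mem_univ i)
    have h2 : ∑ i, |η j i ω| ≤ ∑ j ∈ Finset.range N, ∑ i, |η j i ω| :=
      Finset.single_le_sum (f := fun j => ∑ i, |η j i ω|)
        (fun _ _ => Finset.sum_nonneg fun _ _ => abs_nonneg _) (Finset.mem_range.2 hj)
    have h3 : 1 ≤ √((j : ℝ) + 1) := Real.one_le_sqrt.2 (by linarith [Nat.cast_nonneg (α := ℝ) j])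
    nlinarith
  · have h := hN j hj
    simp only [s, mem_iUnion, mem_ofPred_eq, not_exists, not_le] at h
    have h3 := Real.sqrt_nonneg ((j : ℝ) + 1)
    nlinarith [h i]

/-! ### Dyadic chaining -/

/-- A Lévy-type modulus at the dyadic scale `2⁻ⁿ`. -/
noncomputable def dyadicModulus (n : ℕ) : ℝ := √(((n : ℝ) + 3) / 2 ^ n)

lemma dyadicModulus_nonneg (n : ℕ) : 0 ≤ dyadicModulus n := Real.sqrt_nonneg _

/-- The squares have ratio `(n+4)/(2(n+3)) ≤ 2/3 < (9/10)²`. The shift by 3 gives decay already at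
`n = 0`; with `n + 1` in its place that first ratio would be 1. -/
lemma dyadicModulus_succ_le (n : ℕ) : dyadicModulus (n + 1) ≤ 9 / 10 * dyadicModulus n := by
  unfold dyadicModulus
  rw [show (9 / 10 : ℝ) = √((9 / 10) ^ 2) by rw [Real.sqrt_sq (by norm_num)],
    ← Real.sqrt_mul (by positivity)]
  refine Real.sqrt_le_sqrt ?_
  rw [pow_succ, ← mul_div_assoc, div_le_div_iff₀ (by positivity) (by positivity)]
  have : (0 : ℝ) < 2 ^ n := by positivity
  have hn : (0 : ℝ) ≤ n := by positivity
  push_cast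
  nlinarith [mul_nonneg hn this.le]

/-- The increments of `f` along the dyadic grids of `[0, 1]` are controlled by `C` times the
dyadic modulus. -/
def HasDyadicIncrementBound (f : ℝ → ℝ) (C : ℝ) : Prop :=
  ∀ j m : ℕ, m < 2 ^ j → |f (((m : ℝ) + 1) / 2 ^ j) - f ((m : ℝ) / 2 ^ j)| ≤ C * dyadicModulus j

/-- The left dyadic approximation of `x` at scale `2⁻ⁿ`. -/
noncomputable def dyadicFloor (n : ℕ) (x : ℝ) : ℝ := (⌊2 ^ n * x⌋₊ : ℝ) / 2 ^ n

lemma tendsto_dyadicFloor {x : ℝ} (hx : 0 ≤ x) :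
    Tendsto (fun n => dyadicFloor n x) atTop (𝓝 x) := by
  have h := (tendsto_nat_floor_mul_div_atTop hx).comp
    (tendsto_pow_atTop_atTop_of_one_lt (one_lt_two (α := ℝ)))
  refine h.congr fun n => ?_
  simp [dyadicFloor, mul_comm]

/-- Since `⌊2y⌋` is `2⌊y⌋` or `2⌊y⌋ + 1`, successive approximations coincide or are neighbours on
the finer grid. -/
lemma abs_sub_dyadicFloor_succ_le {f : ℝ → ℝ} {C : ℝ} (hC : 0 ≤ C)
    (hf : HasDyadicIncrementBound f C) {x : ℝ} (hx : x ∈ Icc (0 : ℝ) 1) (n : ℕ) :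
    |f (dyadicFloor (n + 1) x) - f (dyadicFloor n x)| ≤ C * dyadicModulus (n + 1) := by
  obtain ⟨hx0, hx1⟩ := hx
  have hp : (0 : ℝ) < 2 ^ n := by positivity
  set k := ⌊2 ^ n * x⌋₊ with hk
  have hk1 : (k : ℝ) ≤ 2 ^ n * x := Nat.floor_le (by positivity)
  have hk2 : 2 ^ n * x < (k : ℝ) + 1 := Nat.lt_floor_add_one _
  set l := ⌊2 ^ (n + 1) * x⌋₊ with hl
  have hl1 : (l : ℝ) ≤ 2 ^ (n + 1) * x := Nat.floor_le (by positivity)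
  have hl2 : 2 ^ (n + 1) * x < (l : ℝ) + 1 := Nat.lt_floor_add_one _
  rw [pow_succ] at hl1 hl2
  have h1 : 2 * k < l + 1 := by
    have : ((2 * k : ℕ) : ℝ) < (l + 1 : ℕ) := by push_cast; linarith
    exact_mod_cast this
  have h2 : l < 2 * k + 2 := by
    have : (l : ℝ) < (2 * k + 2 : ℕ) := by push_cast; linarith
    exact_mod_cast this
  have hkl : dyadicFloor n x = ((2 * k : ℕ) : ℝ) / 2 ^ (n + 1) := by
    simp only [dyadicFloor, ← hk, pow_succ]
    push_cast
    field_simp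
  obtain h | h : l = 2 * k ∨ l = 2 * k + 1 := by omega
  · rw [hkl, dyadicFloor, ← hl, h, sub_self, abs_zero]
    exact mul_nonneg hC (dyadicModulus_nonneg _)
  · have hlt : 2 * k < 2 ^ (n + 1) := by
      have : (l : ℝ) ≤ (2 ^ (n + 1) : ℕ) := by
        push_cast
        rw [pow_succ]
        nlinarith
      have : l ≤ 2 ^ (n + 1) := by exact_mod_cast this
      omega
    have := hf (n + 1) (2 * k) hlt
    rw [hkl, dyadicFloor, ← hl, h]
    push_cast at this ⊢
    exact this

lemma abs_sub_dyadicFloor_le {f : ℝ → ℝ} (hcont : Continuous f) {C : ℝ} (hC : 0 ≤ C)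
    (hf : HasDyadicIncrementBound f C) {x : ℝ} (hx : x ∈ Icc (0 : ℝ) 1) (n : ℕ) :
    |f x - f (dyadicFloor n x)| ≤ 9 * C * dyadicModulus n := by
  -- The factor 9 is `∑_{k≥1} (9/10)^k`; subtracting `dyadicModulus N` makes the induction close.
  have key : ∀ N, n ≤ N → |f (dyadicFloor N x) - f (dyadicFloor n x)| ≤
      9 * C * (dyadicModulus n - dyadicModulus N) := by
    intro N hN
    induction N, hN using Nat.le_induction with
    | base => simp
    | succ N hN ih =>
      have h1 := abs_sub_dyadicFloor_succ_le hC hf hx N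
      have h2 := abs_sub_le (f (dyadicFloor (N + 1) x)) (f (dyadicFloor N x)) (f (dyadicFloor n x))
      have h3 : C * dyadicModulus (N + 1) ≤ C * (9 / 10 * dyadicModulus N) :=
        mul_le_mul_of_nonneg_left (dyadicModulus_succ_le N) hC
      linarith
  have hlim : Tendsto (fun N => |f (dyadicFloor N x) - f (dyadicFloor n x)|) atTop
      (𝓝 |f x - f (dyadicFloor n x)|) :=
    (((hcont.tendsto x).comp (tendsto_dyadicFloor hx.1)).sub_const _).abs
  refine le_of_tendsto hlim (eventually_atTop.2 ⟨n, fun N hN => (key N hN).trans ?_⟩)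
  have := mul_nonneg hC (dyadicModulus_nonneg N)
  linarith

/-- The dyadic floors of `x` and `y` are equal or adjacent, so passing through them costs `9 + 1 + 9
= 19`. -/
lemma abs_sub_le_of_sub_le_two_pow {f : ℝ → ℝ} (hcont : Continuous f) {C : ℝ} (hC : 0 ≤ C)
    (hf : HasDyadicIncrementBound f C) {x y : ℝ} (hx : x ∈ Icc (0 : ℝ) 1) (hy : y ∈ Icc (0 : ℝ) 1)
    (hxy : x ≤ y) {n : ℕ} (hn : y - x ≤ 1 / 2 ^ n) :
    |f y - f x| ≤ 19 * C * dyadicModulus n := by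
  have hmid : |f (dyadicFloor n y) - f (dyadicFloor n x)| ≤ C * dyadicModulus n := by
    have hp : (0 : ℝ) < 2 ^ n := by positivity
    have hyx : 2 ^ n * y ≤ 2 ^ n * x + 1 := by
      rw [le_div_iff₀ hp] at hn
      linarith
    set k := ⌊2 ^ n * x⌋₊ with hk
    set l := ⌊2 ^ n * y⌋₊ with hl
    have h1 : k ≤ l := Nat.floor_mono (by gcongr)
    have h2 : l ≤ k + 1 := by
      have := Nat.floor_mono hyx
      rwa [Nat.floor_add_one (mul_nonneg hp.le hx.1)] at this
    have h3 : l ≤ 2 ^ n := by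
      have : (l : ℝ) ≤ 2 ^ n * y := Nat.floor_le (mul_nonneg hp.le hy.1)
      have : (l : ℝ) ≤ (2 ^ n : ℕ) := by push_cast; nlinarith [hy.2]
      exact_mod_cast this
    obtain h | h : l = k ∨ l = k + 1 := by omega
    · rw [dyadicFloor, dyadicFloor, ← hl, ← hk, h, sub_self, abs_zero]
      exact mul_nonneg hC (dyadicModulus_nonneg _)
    · have := hf n k (by omega)
      rw [dyadicFloor, dyadicFloor, ← hl, ← hk, h]
      push_cast
      exact this
  have h1 := abs_sub_dyadicFloor_le hcont hC hf hx n
  have h2 := abs_sub_dyadicFloor_le hcont hC hf hy n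
  rw [abs_le] at *
  constructor <;> linarith [hmid.1, hmid.2, h1.1, h1.2, h2.1, h2.2]

/-! ### Faber coefficients -/

lemma abs_faberCoeff_le {f : ℝ → ℝ} {C : ℝ} (hC : 0 ≤ C) (hf : HasDyadicIncrementBound f C)
    {j m : ℕ} (hj : 1 ≤ j) (hm : m < 2 ^ j) : |faberCoeff f j m| ≤ 4 * C * √(j : ℝ) := by
  have hp : (0 : ℝ) < 2 ^ j := by positivity
  have h1 := hf (j + 1) (2 * m) (by rw [pow_succ]; omega)
  have h2 := hf (j + 1) (2 * m + 1) (by rw [pow_succ]; omega)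
  have hd : (fwdDiff (1 / 2 ^ (j + 1) : ℝ))^[2] f ((m : ℝ) / 2 ^ j) =
      (f (((2 * m + 1 : ℕ) + 1) / 2 ^ (j + 1)) - f (((2 * m + 1 : ℕ) : ℝ) / 2 ^ (j + 1))) -
      (f (((2 * m : ℕ) + 1) / 2 ^ (j + 1)) - f (((2 * m : ℕ) : ℝ) / 2 ^ (j + 1))) := by
    have e1 : (m : ℝ) / 2 ^ j = ((2 * m : ℕ) : ℝ) / 2 ^ (j + 1) := by
      rw [pow_succ]; push_cast; field_simp
    simp only [Function.iterate_succ, Function.iterate_zero, Function.comp_apply, id_eq, fwdDiff]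
    rw [e1, ← add_div, ← add_div]
    push_cast
    rfl
  have hs : (2 : ℝ) ^ ((j : ℝ) / 2) * dyadicModulus (j + 1) ≤ 2 * √(j : ℝ) := by
    have e : (2 : ℝ) ^ ((j : ℝ) / 2) = √(2 ^ j) := by
      rw [Real.sqrt_eq_rpow, ← Real.rpow_natCast, ← Real.rpow_mul (by norm_num)]
      ring_nf
    rw [e, dyadicModulus, ← Real.sqrt_mul (by positivity),
      show (2 : ℝ) = √(2 ^ 2) by rw [Real.sqrt_sq (by norm_num)], ← Real.sqrt_mul (by positivity),
      ← show (2 : ℝ) = √(2 ^ 2) by rw [Real.sqrt_sq (by norm_num)]]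
    -- After squaring, the claim is `(j+4)/2 ≤ 4j`, which needs `j ≥ 1`.
    refine Real.sqrt_le_sqrt ?_
    have hj' : (1 : ℝ) ≤ j := by exact_mod_cast hj
    rw [pow_succ, ← mul_div_assoc, div_le_iff₀ (by positivity)]
    push_cast
    nlinarith
  rw [faberCoeff, abs_mul, abs_neg, abs_of_pos (by positivity), hd]
  have h3 := (abs_sub _ _).trans (add_le_add h2 h1)
  calc _ ≤ (2 : ℝ) ^ ((j : ℝ) / 2) * (C * dyadicModulus (j + 1) + C * dyadicModulus (j + 1)) := by
        gcongr
    _ = 2 * C * ((2 : ℝ) ^ ((j : ℝ) / 2) * dyadicModulus (j + 1)) := by ring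
    _ ≤ 2 * C * (2 * √(j : ℝ)) := by gcongr
    _ = _ := by ring

/-! ### Membership in the Besov space -/

/-- Clamping a real number to `[0, 1]`. -/
noncomputable def unitClamp (x : ℝ) : ℝ := max 0 (min 1 x)

lemma continuous_unitClamp : Continuous unitClamp := by unfold unitClamp; fun_prop

lemma unitClamp_mem (x : ℝ) : unitClamp x ∈ Icc (0 : ℝ) 1 := by
  unfold unitClamp; constructor <;> simp

lemma unitClamp_of_mem {x : ℝ} (hx : x ∈ Icc (0 : ℝ) 1) : unitClamp x = x := by
  simp [unitClamp, hx.1, hx.2]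

lemma unitClamp_mono : Monotone unitClamp := fun _ _ h => by unfold unitClamp; gcongr

lemma unitClamp_add_sub_le {x h : ℝ} (hh : 0 ≤ h) : unitClamp (x + h) - unitClamp x ≤ h := by
  unfold unitClamp
  grind

/-- The dyadic modulus compared with the weight of `B^{1/2,1/2}_{∞,∞}`. -/
lemma rpow_mul_rpow_mul_dyadicModulus_le {t : ℝ} {n : ℕ} (ht1 : 1 / 2 ^ (n + 1) < t)
    (ht2 : t ≤ 1 / 2 ^ n) :
    t ^ (-(1 / 2) : ℝ) * (1 + |Real.log t|) ^ (-(1 / 2) : ℝ) * dyadicModulus n ≤ 4 := by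
  have ht : 0 < t := lt_trans (by positivity) ht1
  have hp : (0 : ℝ) < 2 ^ n := by positivity
  have hlog : n * Real.log 2 ≤ |Real.log t| := by
    have := Real.log_le_log ht ht2
    rw [one_div, Real.log_inv, Real.log_pow] at this
    exact (le_neg_of_le_neg this).trans (neg_le_abs _)
  have hn : (0 : ℝ) ≤ n := by positivity
  have hl2 := Real.log_two_gt_d9
  have hA : ((n : ℝ) + 3) / 8 ≤ 1 + |Real.log t| := by nlinarith
  have hb : 1 ≤ 2 * t * 2 ^ n := by
    rw [pow_succ, div_lt_iff₀ (by positivity)] at ht1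
    linarith
  have hpos : 0 < 1 + |Real.log t| := by positivity
  rw [← Real.mul_rpow ht.le hpos.le, Real.rpow_neg (by positivity), ← Real.sqrt_eq_rpow,
    inv_mul_le_iff₀ (by positivity), dyadicModulus, Real.sqrt_le_left (by positivity), mul_pow,
    Real.sq_sqrt (by positivity), div_le_iff₀ hp]
  -- The product of the two bounds is `n + 3 ≤ 16 t (1 + |log t|) 2^n`, and `4 = √16`.
  nlinarith [mul_le_mul hA hb zero_le_one hpos.le]

lemma exists_two_pow_bracket {t : ℝ} (ht : t ∈ Ioo (0 : ℝ) 1) :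
    ∃ n : ℕ, 1 / 2 ^ (n + 1) < t ∧ t ≤ 1 / 2 ^ n := by
  obtain ⟨n, h1, h2⟩ := exists_nat_pow_near_of_lt_one ht.1 ht.2.le
    (y := (1 / 2 : ℝ)) (by norm_num) (by norm_num)
  exact ⟨n, by simpa using h1, by simpa using h2⟩

lemma memLogBesovUnitInterval_of_dyadic {f : ℝ → ℝ} (hcont : Continuous f) {C : ℝ} (hC : 0 ≤ C)
    (hf : HasDyadicIncrementBound f C) :
    MemLogBesovUnitInterval (1 / 2) (1 / 2) ∞ ∞ fun t => (f t : ℂ) := by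
  -- Extend constantly outside `[0,1]`: clamping is monotone and 1-Lipschitz, so the modulus of `f`
  -- on `[0,1]` carries over to `g` on the whole line.
  let g : ℝ → ℂ := fun x => (f (unitClamp x) : ℂ)
  have hgcont : Continuous g :=
    Complex.continuous_ofReal.comp (hcont.comp continuous_unitClamp)
  obtain ⟨B, hB⟩ := isCompact_Icc.exists_bound_of_continuousOn (s := Icc (0 : ℝ) 1)
    hcont.continuousOn
  have hgmem : MemLp g ∞ volume := by
    refine memLp_top_of_bound hgcont.aestronglyMeasurable B (ae_of_all _ fun x => ?_)
    simpa [g] using hB _ (unitClamp_mem x)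
  have hgf : g =ᵐ[volume.restrict (Icc (0 : ℝ) 1)] fun t => (f t : ℂ) := by
    refine (ae_restrict_iff' measurableSet_Icc).2 (ae_of_all _ fun x hx => ?_)
    simp only [g, unitClamp_of_mem hx]
  refine ⟨(memLp_congr_ae hgf).1 (hgmem.restrict _), g, ⟨hgmem, ?_⟩, hgf⟩
  refine ENNReal.add_lt_top.2 ⟨hgmem.eLpNorm_lt_top, ?_⟩
  have hM : ⌊(1 / 2 : ℝ)⌋₊ + 1 = 1 := by norm_num
  rw [hM, eLpNorm_exponent_top]
  refine lt_of_le_of_lt (eLpNormEssSup_le_of_ae_enorm_bound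
    (C := ENNReal.ofReal (4 * (19 * C))) ?_) ENNReal.ofReal_lt_top
  have hae : ∀ᵐ t ∂dtOverT, t ∈ Ioo (0 : ℝ) 1 :=
    (withDensity_absolutelyContinuous _ _).ae_le (ae_restrict_mem measurableSet_Ioo)
  filter_upwards [hae] with t ht
  obtain ⟨n, hn1, hn2⟩ := exists_two_pow_bracket ht
  have hmod : diffModulus 1 ∞ g t ≤ ENNReal.ofReal (19 * C * dyadicModulus n) := by
    refine iSup₂_le fun h hh => ?_
    rw [eLpNorm_exponent_top]
    refine eLpNormEssSup_le_of_ae_bound (ae_of_all _ fun x => ?_)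
    simp only [Function.iterate_one, fwdDiff, g]
    rw [← Complex.ofReal_sub, Complex.norm_real, Real.norm_eq_abs]
    refine abs_sub_le_of_sub_le_two_pow hcont hC hf (unitClamp_mem _) (unitClamp_mem _)
      (unitClamp_mono (by linarith [hh.1])) ?_
    exact (unitClamp_add_sub_le hh.1.le).trans (hh.2.le.trans hn2)
  rw [enorm_eq_self]
  have hw : 0 ≤ t ^ (-(1 / 2) : ℝ) * (1 + |Real.log t|) ^ (-(1 / 2) : ℝ) := by
    have := ht.1.le
    positivity
  calc _ ≤ ENNReal.ofReal (t ^ (-(1 / 2) : ℝ) * (1 + |Real.log t|) ^ (-(1 / 2) : ℝ)) *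
        ENNReal.ofReal (19 * C * dyadicModulus n) := by gcongr
    _ = ENNReal.ofReal (t ^ (-(1 / 2) : ℝ) * (1 + |Real.log t|) ^ (-(1 / 2) : ℝ) *
        dyadicModulus n * (19 * C)) := by
        rw [← ENNReal.ofReal_mul hw]
        ring_nf
    _ ≤ _ := by
        refine ENNReal.ofReal_le_ofReal ?_
        gcongr
        exact rpow_mul_rpow_mul_dyadicModulus_le hn1 hn2

/-! ### Brownian increments and conclusion -/

lemma ae_exists_hasDyadicIncrementBound_samplePath {Ω : Type*} [MeasurableSpace Ω] {P : Measure Ω}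
    [IsProbabilityMeasure P] {W : ℝ≥0 → Ω → ℝ} (hW : IsPreBrownianReal W P) :
    ∀ᵐ ω ∂P, ∃ C : ℝ, 0 ≤ C ∧ HasDyadicIncrementBound (samplePath W ω) C := by
  let η : ∀ j : ℕ, Fin (2 ^ j) → Ω → ℝ := fun j m ω =>
    √(2 ^ j) * (W (((m : ℝ) + 1) / 2 ^ j).toNNReal - W ((m : ℝ) / 2 ^ j).toNNReal) ω
  have hη : ∀ j i, HasLaw (η j i) (gaussianReal 0 1) P := by
    intro j i
    convert gaussianReal_const_mul (hW.hasLaw_sub (((i : ℝ) + 1) / 2 ^ j).toNNReal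
      ((i : ℝ) / 2 ^ j).toNNReal) √(2 ^ j) using 2
    · simp
    · ext
      have hp : (0 : ℝ) < 2 ^ j := by positivity
      simp only [NNReal.coe_mul, NNReal.coe_mk, coe_nndist, NNReal.coe_one]
      rw [Real.sq_sqrt hp.le, Real.dist_eq]
      change 1 = 2 ^ j * |((((i : ℝ) + 1) / 2 ^ j).toNNReal : ℝ) - (((i : ℝ) / 2 ^ j).toNNReal : ℝ)|
      rw [Real.coe_toNNReal _ (by positivity), Real.coe_toNNReal _ (by positivity), ← sub_div,
        add_sub_cancel_left, abs_of_pos (by positivity)]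
      field_simp
  filter_upwards [ae_exists_abs_le_mul_sqrt (ι := fun j => Fin (2 ^ j))
    (fun j => by simp [pow_succ]) η hη] with ω ⟨C, hC, h⟩
  refine ⟨C, hC, fun j m hm => ?_⟩
  have hj := h j ⟨m, hm⟩
  have hp : (0 : ℝ) < √(2 ^ j) := by positivity
  simp only [η, Pi.sub_apply] at hj
  rw [abs_mul, abs_of_pos hp, ← le_div_iff₀' hp, mul_div_assoc,
    ← Real.sqrt_div (by positivity)] at hj
  refine hj.trans (mul_le_mul_of_nonneg_left (Real.sqrt_le_sqrt ?_) hC)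
  gcongr
  norm_num

lemma iSup_ofReal_abs_div_sqrt_lt_top {a : ∀ j : ℕ+, Fin (2 ^ (j : ℕ)) → ℝ} {C : ℝ}
    (h : ∀ j m, |a j m| ≤ C * √(j : ℝ)) :
    (⨆ (j : ℕ+) (m : Fin (2 ^ (j : ℕ))), ENNReal.ofReal (|a j m| / √(j : ℝ))) < ∞ := by
  refine lt_of_le_of_lt (iSup₂_le fun j m => ENNReal.ofReal_le_ofReal ?_)
    (ENNReal.ofReal_lt_top (r := C))
  have : (0 : ℝ) < j := by exact_mod_cast j.pos
  exact (div_le_iff₀ (by positivity)).2 (h j m)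

theorem mainTheorem8 {Ω : Type*} [MeasurableSpace Ω] (P : Measure Ω) [IsProbabilityMeasure P] :
    (∀ ξ : (Σ j : ℕ+, Fin (2 ^ (j : ℕ))) → Ω → ℝ,
      (∀ i, HasLaw (ξ i) (gaussianReal 0 1) P) → iIndepFun ξ P →
        ∀ᵐ ω ∂P, (⨆ (j : ℕ+) (m : Fin (2 ^ (j : ℕ))),
          ENNReal.ofReal (|ξ ⟨j, m⟩ ω| / √(j : ℝ))) < ∞) ∧
    (∀ W : ℝ≥0 → Ω → ℝ, IsBrownianReal W P →
      (∀ᵐ ω ∂P, (⨆ (j : ℕ+) (m : Fin (2 ^ (j : ℕ))),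
        ENNReal.ofReal (|faberCoeff (samplePath W ω) j m| / √(j : ℝ))) < ∞) ∧
      (∀ᵐ ω ∂P,
        MemLogBesovUnitInterval (1 / 2) (1 / 2) ∞ ∞ fun t => (samplePath W ω t : ℂ))) := by

  refine ⟨fun ξ hξ _ => ?_, fun W hW => ⟨?_, ?_⟩⟩
  -- Levels start at 1, so level `j + 1` is indexed by `j`; this is why `2^(j+1)` variables are
  -- allowed there.
  · filter_upwards [ae_exists_abs_le_mul_sqrt (ι := fun j => Fin (2 ^ (j + 1)))
      (fun j => by simp) (fun j m => ξ ⟨j.succPNat, m⟩) (fun j m => hξ _)] with ω ⟨C, _, h⟩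
    refine iSup_ofReal_abs_div_sqrt_lt_top (C := C) fun j => ?_
    obtain ⟨n, rfl⟩ : ∃ n : ℕ, j = n.succPNat := ⟨j.natPred, (PNat.succPNat_natPred j).symm⟩
    intro m
    simpa using h n m
  · filter_upwards [ae_exists_hasDyadicIncrementBound_samplePath hW.toIsPreBrownianReal]
      with ω ⟨C, hC, h⟩
    exact iSup_ofReal_abs_div_sqrt_lt_top fun j m => abs_faberCoeff_le hC h j.pos m.2
  · filter_upwards [ae_exists_hasDyadicIncrementBound_samplePath hW.toIsPreBrownianReal, hW.cont]
      with ω ⟨C, hC, h⟩ hcont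
    exact memLogBesovUnitInterval_of_dyadic (hcont.comp continuous_real_toNNReal) hC h
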